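/- For a Tychonoff space $X$ let $C(X)$ be the ring of continuous functions $X\to\mathbb R$, and let $C_k(X)$ be $C(X)$ with the compact-open topology; it is a Hausdorff real locally convex space, and in particular an abelian topological group under addition. The space $X$ is realcompact if it is Tychonoff and every maximal ideal $M$ of $C(X)$ whose residue field $C(X)/M$ is the (canonical copy of the) field $\mathbb R$ is fixed, i.e. all members of $M$ vanish at a common point of $X$. For an abelian topological group $(G,\tau)$ let $\widehat{(G,\tau)}$ be the set of its continuous characters, i.e. of the continuous homomorphisms from $G$ to the unit circle $\mathbb S$, and let $\mathbb S_+=\{z\in\mathbb S:\operatorname{Re} z\ge 0\}$. A set $A\subseteq G$ is quasi-convex if for every $g\in G\setminus A$ there is $\chi\in\widehat{(G,\tau)}$ with $\chi(A)\subseteq\mathbb S_+$ and $\chi(g)\notin\mathbb S_+$. A Hausdorff group topology $\tau$ on $G$ is locally quasi-convex if $0$ has a neighborhood base of quasi-convex sets. Two topologies $\tau,\nu$ on $G$ are compatible if $\widehat{(G,\tau)}=\widehat{(G,\nu)}$. A locally quasi-convex group $(G,\tau)$ is a Mackey group if $\nu\subseteq\tau$ for every locally quasi-convex group topology $\nu$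 on $G$ that is compatible with $\tau$. **Theorem.** For a realcompact space $X$, the space $C_k(X)$ is barrelled if and only if it is a Mackey group. -/

import Mathlib

open Topology

/-- A maximal ideal `M` of the ring `C(X)` of continuous real functions is *real* if its residue
field `C(X) / M` is (the canonical copy of) the field of real numbers. -/
def IsRealMaximalIdeal {X : Type*} [TopologicalSpace X] (M : Ideal C(X, ℝ)) : Prop :=
  M.IsMaximal ∧ Function.Surjective (algebraMap ℝ (C(X, ℝ) ⧸ M))

/-- A space `X` is *realcompact* if it is Tychonoff and every real maximal ideal of `C(X)` is fixed,
that is, all its members vanish at a common point of `X`. -/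
def IsRealcompact (X : Type*) [TopologicalSpace X] : Prop :=
  T35Space X ∧ ∀ M : Ideal C(X, ℝ), IsRealMaximalIdeal M → ∃ x : X, ∀ f ∈ M, f x = 0

/-- The set of continuous characters of the abelian group `G` with the topology `τ`: the
homomorphisms from `G` to the unit circle that are continuous for `τ`. -/
def continuousCharacters (G : Type*) [AddCommGroup G] (τ : TopologicalSpace G) :
    Set (AddChar G Circle) :=
  {χ | Continuous[τ, inferInstance] (χ : G → Circle)}

/-- A subset `A` of `(G, τ)` is *quasi-convex* if for each `g ∉ A` some continuous character maps
`A` into `{z : 0 ≤ Re z}` and `g` outside of it. -/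
def IsQuasiConvex {G : Type*} [AddCommGroup G] (τ : TopologicalSpace G) (A : Set G) : Prop :=
  ∀ g, g ∉ A → ∃ χ ∈ continuousCharacters G τ,
    ¬ (0 ≤ (χ g : ℂ).re) ∧ ∀ a ∈ A, 0 ≤ (χ a : ℂ).re

/-- `τ` is a *locally quasi-convex group topology* on `G`: a Hausdorff group topology for which `0`
has a neighborhood base of quasi-convex sets. -/
structure IsLocallyQuasiConvex {G : Type*} [AddCommGroup G] (τ : TopologicalSpace G) : Prop where
  isTopologicalAddGroup : @IsTopologicalAddGroup G τ _
  t2Space : @T2Space G τ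
  exists_quasiConvex : ∀ V ∈ @nhds G τ 0, ∃ U ∈ @nhds G τ 0, IsQuasiConvex τ U ∧ U ⊆ V

/-- Two topologies on `G` are *compatible* if they have the same continuous characters. -/
def CompatibleTopologies {G : Type*} [AddCommGroup G] (τ ν : TopologicalSpace G) : Prop :=
  continuousCharacters G τ = continuousCharacters G ν

/-- `G` is a *Mackey group*: it is locally quasi-convex, and its topology is finer than every
compatible locally quasi-convex group topology on `G` (in the order on `TopologicalSpace G`,
`τ ≤ ν` says that `τ` is finer than `ν`). -/
def IsMackeyGroup (G : Type*) [AddCommGroup G] [τ : TopologicalSpace G] : Prop :=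
  IsLocallyQuasiConvex τ ∧
    ∀ ν : TopologicalSpace G, IsLocallyQuasiConvex ν → CompatibleTopologies τ ν → τ ≤ ν

/-!
Barrelled implies Mackey for every Hausdorff real locally convex space `E`, with no reference to
function spaces. Let `U` be a quasi-convex neighborhood of `0` for a compatible locally quasi-convex
group topology. An ultrafilter limit of characters in the polar of `U` is again a character in this
polar, and it is continuous because the half circle contains no nontrivial subgroup
(`AddChar.continuous_of_re_nonneg`). Continuous characters of `E` are the maps `exp (i f)` with `f`
in the dual of `E` (`AddChar.exists_continuousLinearMap_eq_exp`). If the functionals `f` in the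
polar were unbounded at a point `x`, then some of their values at `x` would form a lacunary
sequence, and a multiple `t x` could be chosen at which the characters stay away from any limit
`exp (i g)` (`Real.not_forall_tendsto_exp_mul`). So the polar is pointwise bounded, hence
equicontinuous by barrelledness, and `U` is a neighborhood of `0` in `E`.

For the converse, realcompactness makes `C(X, ℝ)` barrelled, so that for realcompact `X` both sides
of the equivalence hold. This is half of the Nachbin-Shirota theorem. A lower semicontinuous
seminorm `p` on `C(X, ℝ)` has a closed support in `X`, and `p f` depends only on the values of `f`
there (`Seminorm.eq_zero_of_eqOn_zero`). The support is functionally bounded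
(`Seminorm.exists_forall_mem_support_abs_le`), and a closed functionally bounded subset of a
realcompact space is compact (`IsRealcompact.isCompact_of_isClosed`). Comparison with the Banach
space of bounded continuous functions bounds `p` by a multiple of the supremum over the support, a
continuous seminorm for the compact-open topology.
-/

/-! ### Characters of topological groups and of locally convex spaces -/

open Filter in
/-- A pointwise limit of characters along an ultrafilter exists and is again a character, because
`Circle` is compact. -/
theorem AddChar.exists_tendsto_ultrafilter {G ι : Type*} [AddMonoid G] (F : Ultrafilter ι)
    (χ : ι → AddChar G Circle) :
    ∃ ψ : AddChar G Circle, ∀ x, Tendsto (fun i => χ i x) F (𝓝 (ψ x)) := by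
  have h : ∀ x, ∃ z : Circle, Tendsto (fun i => χ i x) F (𝓝 z) := fun x => by
    obtain ⟨z, -, hz⟩ := isCompact_univ.ultrafilter_le_nhds (F.map fun i => χ i x) (by simp)
    exact ⟨z, hz⟩
  choose z hz using h
  refine ⟨⟨z, ?_, fun x y => ?_⟩, hz⟩
  · exact tendsto_nhds_unique (hz 0) (by simp)
  · exact tendsto_nhds_unique (hz (x + y)) <| by
      simpa [AddChar.map_add_eq_mul] using (hz x).mul (hz y)

theorem Circle.re_exp (t : ℝ) : ((Circle.exp t : Circle) : ℂ).re = Real.cos t := by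
  rw [Circle.coe_exp, Complex.exp_ofReal_mul_I_re]

/-- If the first `N + 1` multiples of the angle `θ` lie in the right half circle, then `θ` is small:
inductively no multiple can jump over the left half circle. -/
theorem Real.mul_abs_le_of_forall_cos_nonneg {θ : ℝ} (hθ : |θ| ≤ Real.pi) (N : ℕ)
    (h : ∀ k ≤ N + 1, 0 ≤ Real.cos (k * θ)) : (N + 1) * |θ| ≤ Real.pi / 2 := by
  have hpi := Real.pi_pos
  -- If `0 ≤ cos y` and `|y| ≤ π`, then `|y| ≤ π / 2`.
  have key : ∀ y : ℝ, 0 ≤ y → y ≤ Real.pi → 0 ≤ Real.cos y → y ≤ Real.pi / 2 := by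
    intro y _ h1 h2
    by_contra! h3
    exact absurd (Real.cos_neg_of_pi_div_two_lt_of_lt h3 (by linarith)) (not_lt.2 h2)
  have hcos : ∀ k : ℕ, Real.cos (k * θ) = Real.cos (k * |θ|) := fun k => by
    rw [← Real.cos_abs, abs_mul, Nat.abs_cast]
  induction N with
  | zero =>
    have := h 1 (by simp)
    rw [hcos] at this
    simpa using key |θ| (abs_nonneg _) hθ (by simpa using this)
  | succ N ih =>
    have ih' := ih fun k hk => h k (by omega)
    have h2 := h (N + 2) (by omega)
    rw [hcos] at h2
    push_cast at h2 ⊢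
    refine le_trans (le_of_eq (by ring)) (key ((N + 2) * |θ|) (by positivity) ?_ h2)
    have : |θ| ≤ (N + 1) * |θ| := by nlinarith [abs_nonneg θ, (Nat.cast_nonneg N : (0 : ℝ) ≤ N)]
    linarith

/-- The half circle contains no nontrivial subgroup, so a character sending a neighborhood of `0`
into it is continuous. -/
theorem AddChar.continuous_of_re_nonneg {G : Type*} [AddCommGroup G] [TopologicalSpace G]
    [IsTopologicalAddGroup G] {U : Set G} (hU : U ∈ 𝓝 (0 : G)) {χ : AddChar G Circle}
    (h : ∀ u ∈ U, 0 ≤ (χ u : ℂ).re) : Continuous χ := by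
  have hhom : Continuous (χ.toMonoidHom : Multiplicative G →* Circle) := by
    refine continuous_of_continuousAt_one _ ?_
    rw [ContinuousAt, map_one, Metric.tendsto_nhds]
    intro ε hε
    obtain ⟨N, hN⟩ := exists_nat_gt (Real.pi / ε)
    have hev : ∀ᶠ v in 𝓝 (0 : G), ∀ k ∈ Finset.range (N + 2), k • v ∈ U := by
      rw [Filter.eventually_all_finset]
      intro k _
      have : Filter.Tendsto (fun v : G => k • v) (𝓝 0) (𝓝 0) := by
        simpa using (continuous_nsmul k).tendsto (0 : G)
      exact this hU
    change ∀ᶠ v in 𝓝 (0 : G), dist (χ v) 1 < ε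
    filter_upwards [hev] with v hv
    set θ := Complex.arg (χ v)
    have hθ : Circle.exp θ = χ v := Circle.exp_arg _
    have hk := Real.mul_abs_le_of_forall_cos_nonneg (θ := θ) (Complex.abs_arg_le_pi _) N
      fun k hk => by
        have := h _ (hv k (by simp; omega))
        rwa [AddChar.map_nsmul_eq_pow, ← hθ, ← Circle.exp_natCast_mul, Circle.re_exp] at this
    have hle : dist (χ v) 1 ≤ |θ| := by
      change dist (χ v : ℂ) 1 ≤ |θ|
      rw [← hθ, Complex.dist_eq, Circle.coe_exp, mul_comm]
      exact Real.norm_exp_I_mul_ofReal_sub_one_le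
    refine hle.trans_lt ?_
    rw [div_lt_iff₀ hε] at hN
    by_contra! hcon
    nlinarith [Real.pi_pos, abs_nonneg θ, (Nat.cast_nonneg N : (0 : ℝ) ≤ N),
      mul_le_mul_of_nonneg_left hcon (Nat.cast_nonneg N : (0 : ℝ) ≤ N)]
  exact hhom

/-- The continuous characters of a real locally convex space `E` are the maps `exp (i f)` with `f`
in the topological dual: `E` is simply connected, so a character lifts along the covering
`Circle.exp`, and the lift is additive since `ℝ → Circle` has discrete kernel. -/
theorem AddChar.exists_continuousLinearMap_eq_exp {E : Type*} [AddCommGroup E] [Module ℝ E]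
    [TopologicalSpace E] [IsTopologicalAddGroup E] [ContinuousSMul ℝ E] [LocallyConvexSpace ℝ E]
    {χ : AddChar E Circle} (hχ : Continuous χ) :
    ∃ f : E →L[ℝ] ℝ, ∀ x, χ x = Circle.exp (f x) := by
  have hloc : LocallyPathConnectedSpace E := LocallyConvexSpace.toLocallyPathConnectedSpace E
  obtain ⟨F, ⟨hF0, hF⟩, -⟩ := Circle.isCoveringMap_exp.existsUnique_continuousMap_lifts
    ⟨χ, hχ⟩ (0 : E) 0 (by simp)
  replace hF : ∀ x, Circle.exp (F x) = χ x := fun x => congrFun hF x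
  have hadd : ∀ x y, F (x + y) = F x + F y := by
    intro x y
    -- Both sides, as functions of `y`, lift `y ↦ χ (x + y)` and agree at `0`.
    have := Circle.isCoveringMap_exp.eq_of_comp_eq (A := E)
      (g₁ := fun y => F (x + y)) (g₂ := fun y => F x + F y) (by fun_prop) (by fun_prop)
      (by
        funext y
        simp [hF, AddChar.map_add_eq_mul, Circle.exp_add]) 0 (by simp [hF0])
    exact congrFun this y
  refine ⟨(AddMonoidHom.mk' F hadd).toRealLinearMap F.continuous, fun x => (hF x).symm⟩

/-! ### Lacunary sequences and Bohr compactness on the real line -/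

/-- For a lacunary sequence `b` some `t` keeps all `b n * t` in the half-line where the cosine is
nonpositive: the maximal intervals around `(2 m + 1) π / b n` on which `cos (b n * t) ≤ 0` can be
chosen nested. -/
theorem Real.exists_forall_cos_mul_nonpos {b : ℕ → ℝ} (h0 : ∀ n, 0 < b n)
    (hb : ∀ n, 3 * b n ≤ b (n + 1)) : ∃ t, ∀ n, Real.cos (b n * t) ≤ 0 := by
  have hpi := Real.pi_pos
  have hstep : ∀ (n : ℕ) (m : ℤ), ∃ m' : ℤ,
      |(2 * m' + 1) * Real.pi / b (n + 1) - (2 * m + 1) * Real.pi / b n| ≤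
        Real.pi / b (n + 1) := by
    intro n m
    have h1 := h0 (n + 1)
    set c := (2 * m + 1) * Real.pi / b n
    refine ⟨round ((c * b (n + 1) / Real.pi - 1) / 2), ?_⟩
    have hr := abs_sub_round ((c * b (n + 1) / Real.pi - 1) / 2)
    set r : ℤ := round ((c * b (n + 1) / Real.pi - 1) / 2)
    have : (2 * r + 1) * Real.pi / b (n + 1) - c =
        -(2 * Real.pi / b (n + 1)) * ((c * b (n + 1) / Real.pi - 1) / 2 - r) := by
      field_simp
      ring
    rw [this, abs_mul, abs_neg, abs_of_pos (by positivity)]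
    calc 2 * Real.pi / b (n + 1) * |(c * b (n + 1) / Real.pi - 1) / 2 - r|
        ≤ 2 * Real.pi / b (n + 1) * (1 / 2) := by gcongr
      _ = Real.pi / b (n + 1) := by ring
  choose s hs using hstep
  obtain ⟨m, hm⟩ : ∃ m : ℕ → ℤ, ∀ n, m (n + 1) = s n (m n) :=
    ⟨fun n => Nat.rec 0 s n, fun n => rfl⟩
  -- The nested intervals have centers `c n` and half-lengths `d n`.
  let c : ℕ → ℝ := fun n => (2 * m n + 1) * Real.pi / b n
  let d : ℕ → ℝ := fun n => Real.pi / b n / 2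
  have hc : ∀ n, |c (n + 1) - c n| ≤ 2 * d (n + 1) := fun n => by
    simpa [c, d, hm, mul_div_cancel₀] using hs n (m n)
  have hd : ∀ n, 3 * d (n + 1) ≤ d n := fun n => by
    have h1 := h0 n
    have h2 : Real.pi / b (n + 1) ≤ Real.pi / (3 * b n) :=
      div_le_div_of_nonneg_left hpi.le (by positivity) (hb n)
    have h3 : Real.pi / (3 * b n) = Real.pi / b n / 3 := by field_simp
    simp only [d]
    linarith
  have hd0 : ∀ n, 0 < d n := fun n => by have := h0 n; positivity
  have hanti : Antitone fun n => Set.Icc (c n - d n) (c n + d n) := by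
    refine antitone_nat_of_succ_le fun n => Set.Icc_subset_Icc ?_ ?_ <;>
    · have := abs_le.1 (hc n)
      linarith [hd n]
  have hmem := ciSup_mem_iInter_Icc_of_antitone_Icc hanti fun n => by linarith [hd0 n]
  set t := ⨆ n, (c n - d n)
  refine ⟨t, fun n => ?_⟩
  have ht := Set.mem_iInter.1 hmem n
  have hbn := h0 n
  have hcb : b n * c n = Real.pi + m n * (2 * Real.pi) := by simp only [c]; field_simp; ring
  have hdb : b n * d n = Real.pi / 2 := by simp only [d]; field_simp
  have e : b n * t = (b n * (t - c n) + Real.pi) + m n * (2 * Real.pi) := by linarith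
  rw [e, Real.cos_add_int_mul_two_pi, Real.cos_add_pi, neg_nonpos]
  refine Real.cos_nonneg_of_neg_pi_div_two_le_of_le ?_ ?_ <;>
    nlinarith [mul_le_mul_of_nonneg_left ht.1 hbn.le, mul_le_mul_of_nonneg_left ht.2 hbn.le]

/-- Unbounded sets of reals are not compact for the Bohr topology: if the `a n` grow geometrically,
then no nonprincipal ultrafilter limit of the characters `t ↦ exp (i a n t)` is a continuous
character `t ↦ exp (i l t)`. -/
theorem Real.not_forall_tendsto_exp_mul {a : ℕ → ℝ} (ha1 : 1 ≤ |a 0|)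
    (ha : ∀ n, 4 * |a n| + 1 ≤ |a (n + 1)|) (F : Ultrafilter ℕ)
    (hF : (F : Filter ℕ) ≤ Filter.atTop) (l : ℝ) :
    ¬ ∀ t, Filter.Tendsto (fun n => Circle.exp (t * a n)) F (𝓝 (Circle.exp (t * l))) := by
  intro h
  have hn : ∀ n : ℕ, (n : ℝ) + 1 ≤ |a n| := fun n => by
    induction n with
    | zero => simpa using ha1
    | succ n ih => push_cast; linarith [ha n, abs_nonneg (a n)]
  obtain ⟨N, hN⟩ := exists_nat_ge (4 * |l|)
  -- From the index `N` on, the differences `a n - l` are lacunary.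
  have hN' : ∀ n, 4 * |l| + 1 ≤ |a (n + N)| := fun n => by
    have := hn (n + N)
    push_cast at this
    linarith [(Nat.cast_nonneg n : (0 : ℝ) ≤ n)]
  obtain ⟨t, ht⟩ := Real.exists_forall_cos_mul_nonpos (b := fun n => |a (n + N) - l|)
    (fun n => by
      have h1 := abs_sub_abs_le_abs_sub (a (n + N)) l
      linarith [hN' n, abs_nonneg l])
    (fun n => by
      have h1 := abs_sub_abs_le_abs_sub (a (n + 1 + N)) l
      have h2 := abs_sub (a (n + N)) l
      have h3 := ha (n + N)
      rw [show n + N + 1 = n + 1 + N by ring] at h3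
      linarith [hN' n])
  have hcos : ∀ n, Real.cos (t * a (n + N) - t * l) ≤ 0 := fun n => by
    have := ht n
    rw [← Real.cos_abs, abs_mul, abs_abs, ← abs_mul, Real.cos_abs] at this
    rwa [← mul_sub, mul_comm]
  have hlim : Filter.Tendsto (fun n => ((Circle.exp (t * a n) / Circle.exp (t * l) : Circle) : ℂ).re)
      F (𝓝 1) := by
    have h1 := (h t).div_const (Circle.exp (t * l))
    rw [div_self'] at h1
    have h2 : Continuous fun z : Circle => (z : ℂ).re := by fun_prop
    have h3 := (h2.tendsto 1).comp h1
    rwa [Circle.coe_one, Complex.one_re] at h3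
  have hle : ∀ᶠ n in (F : Filter ℕ),
      ((Circle.exp (t * a n) / Circle.exp (t * l) : Circle) : ℂ).re ≤ 0 := by
    filter_upwards [hF (Filter.eventually_ge_atTop N)] with n hn
    obtain ⟨k, rfl⟩ := Nat.exists_eq_add_of_le' hn
    rw [← Circle.exp_sub, Circle.re_exp]
    exact hcos k
  exact absurd (le_of_tendsto hlim hle) (by norm_num)

/-! ### Locally convex spaces as locally quasi-convex groups -/

/-- Every Hausdorff real locally convex space is a locally quasi-convex group: by Hahn-Banach a
closed absolutely convex neighborhood is separated from a point `g` outside it by a functional `f`,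
and a suitable multiple of `f` separates them modulo `2π`. -/
theorem IsLocallyQuasiConvex.of_locallyConvexSpace (E : Type*) [AddCommGroup E] [Module ℝ E]
    [TopologicalSpace E] [IsTopologicalAddGroup E] [ContinuousSMul ℝ E] [LocallyConvexSpace ℝ E]
    [T2Space E] : IsLocallyQuasiConvex (inferInstance : TopologicalSpace E) where
  isTopologicalAddGroup := inferInstance
  t2Space := inferInstance
  exists_quasiConvex V hV := by
    have hpi := Real.pi_pos
    obtain ⟨U, ⟨hU, hUc, hUa⟩, hUV⟩ := (nhds_hasBasis_absConvex_closed ℝ E).mem_iff.1 hV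
    refine ⟨U, hU, fun g hg => ?_, hUV⟩
    obtain ⟨f, u, hfu, hug⟩ := geometric_hahn_banach_closed_point hUa.2 hUc hg
    have hu : 0 < u := by simpa using hfu 0 (mem_of_mem_nhds hU)
    have habs : ∀ a ∈ U, |f a| < u := fun a ha => by
      have := hfu (-a) (hUa.1.neg_mem_iff.2 ha)
      rw [map_neg] at this
      exact abs_lt.2 ⟨by linarith, hfu a ha⟩
    -- The multiple `c` has to satisfy `c * u ≤ π / 2 < c * f g < 3 π / 2`.
    obtain ⟨c, hc, hcu, hcg, hcg'⟩ : ∃ c : ℝ, 0 < c ∧ c * u ≤ Real.pi / 2 ∧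
        Real.pi / 2 < c * f g ∧ c * f g ≤ Real.pi := by
      rcases le_total (f g) (2 * u) with h | h
      · have e : Real.pi / (2 * u) * u = Real.pi / 2 := by field_simp
        refine ⟨Real.pi / (2 * u), by positivity, e.le, ?_, ?_⟩
        · rw [← e]; gcongr
        · calc Real.pi / (2 * u) * f g ≤ Real.pi / (2 * u) * (2 * u) := by gcongr
            _ = Real.pi := by field_simp
      · have hg0 : 0 < f g := hu.trans hug
        have e : Real.pi / f g * f g = Real.pi := by field_simp
        refine ⟨Real.pi / f g, by positivity, ?_, by linarith, e.le⟩
        calc Real.pi / f g * u ≤ Real.pi / f g * (f g / 2) := by gcongr; linarith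
          _ = Real.pi / 2 := by field_simp
    let χ : AddChar E Circle :=
      ⟨fun x => Circle.exp (c * f x), by simp, fun x y => by simp [mul_add, Circle.exp_add]⟩
    have hχ : ∀ x, (χ x : ℂ).re = Real.cos (c * f x) := fun x => Circle.re_exp _
    refine ⟨χ, ?_, ?_, fun a ha => ?_⟩
    · change Continuous fun x => Circle.exp (c * f x)
      fun_prop
    · rw [hχ, not_le]
      exact Real.cos_neg_of_pi_div_two_lt_of_lt hcg (by linarith)
    · rw [hχ, ← Real.cos_abs, abs_mul, abs_of_pos hc]
      have : c * |f a| ≤ c * u := by gcongr; exact (habs a ha).le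
      exact Real.cos_nonneg_of_neg_pi_div_two_le_of_le (by have := abs_nonneg (f a); nlinarith)
        (this.trans hcu)

/-! ### Barrelled spaces are Mackey groups -/

/-- In a barrelled space `E`, a quasi-convex neighborhood `U` of `0` for a compatible group topology
`ν` is a neighborhood of `0`. The polar of `U` is compact for pointwise convergence and, by
compatibility, consists of characters `exp (i f)` with `f` in the dual of `E`. On each line
compactness forces the functionals `f` to be bounded, so they are equicontinuous. -/
theorem IsQuasiConvex.mem_nhds_zero_of_barrelledSpace {E : Type*} [AddCommGroup E] [Module ℝ E]
    {ν : TopologicalSpace E} [τ : TopologicalSpace E] [IsTopologicalAddGroup E]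
    [ContinuousSMul ℝ E] [LocallyConvexSpace ℝ E] [BarrelledSpace ℝ E]
    (hν : @IsTopologicalAddGroup E ν _) (hcomp : CompatibleTopologies τ ν) {U : Set E}
    (hU : U ∈ @nhds E ν 0) (hUq : IsQuasiConvex ν U) : U ∈ 𝓝 (0 : E) := by
  let K := {f : E →L[ℝ] ℝ // ∀ u ∈ U, 0 ≤ Real.cos (f u)}
  let χ : K → AddChar E Circle := fun f =>
    ⟨fun x => Circle.exp (f.1 x), by simp, fun x y => by simp [Circle.exp_add]⟩
  let p : K → Seminorm ℝ E := fun f => (normSeminorm ℝ ℝ).comp f.1.toLinearMap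
  have hbdd : BddAbove (Set.range p) := by
    refine Seminorm.bddAbove_range_iff.2 fun x => ?_
    by_contra hunb
    have hex : ∀ M : ℝ, ∃ f : K, M ≤ |f.1 x| := fun M => by
      by_contra! hM
      exact hunb ⟨M, by rintro _ ⟨f, rfl⟩; exact (hM f).le⟩
    choose s hs using hex
    obtain ⟨f, hf0, hf⟩ : ∃ f : ℕ → K, f 0 = s 1 ∧ ∀ n, f (n + 1) = s (4 * |(f n).1 x| + 1) :=
      ⟨fun n => Nat.rec (s 1) (fun _ g => s (4 * |g.1 x| + 1)) n, rfl, fun _ => rfl⟩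
    obtain ⟨ψ, hψ⟩ := AddChar.exists_tendsto_ultrafilter (Filter.hyperfilter ℕ) fun n => χ (f n)
    have hψν : ψ ∈ continuousCharacters E ν := by
      refine @AddChar.continuous_of_re_nonneg E _ ν hν U hU ψ fun u hu => ?_
      have h2 : Continuous fun z : Circle => (z : ℂ).re := by fun_prop
      refine ge_of_tendsto' ((h2.tendsto _).comp (hψ u)) fun n => ?_
      exact ((f n).2 u hu).trans_eq (Circle.re_exp _).symm
    rw [← hcomp] at hψν
    obtain ⟨g, hg⟩ := AddChar.exists_continuousLinearMap_eq_exp hψν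
    refine Real.not_forall_tendsto_exp_mul (a := fun n => (f n).1 x) (hf0 ▸ hs 1)
      (fun n => (hs _).trans_eq (by rw [hf])) (Filter.hyperfilter ℕ) Nat.hyperfilter_le_atTop
      (g x) fun t => ?_
    have := hψ (t • x)
    rw [hg, map_smul] at this
    simpa [χ] using this
  let S : Seminorm ℝ E := ⨆ f, p f
  have hcont : Continuous S := by
    rw [Seminorm.coe_iSup_eq hbdd]
    refine Seminorm.continuous_iSup p (fun f => ?_) hbdd
    exact f.1.continuous.abs
  have hpi := Real.pi_pos
  have hball : ∀ᶠ x in 𝓝 (0 : E), S x < Real.pi / 2 :=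
    hcont.continuousAt.eventually_lt_const (by rw [map_zero S]; positivity)
  filter_upwards [hball] with x hx
  by_contra hxU
  obtain ⟨ψ, hψν, hψx, hψU⟩ := hUq x hxU
  rw [← hcomp] at hψν
  obtain ⟨g, hg⟩ := AddChar.exists_continuousLinearMap_eq_exp hψν
  simp only [hg, Circle.re_exp] at hψx hψU
  have hle : |g x| ≤ S x := le_ciSup hbdd (⟨g, hψU⟩ : K) x
  have := abs_le.1 (hle.trans hx.le)
  exact hψx (Real.cos_nonneg_of_neg_pi_div_two_le_of_le (by linarith) this.2)

theorem TopologicalSpace.le_of_nhds_zero_le {G : Type*} [AddGroup G] {τ ν : TopologicalSpace G}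
    (hτ : @IsTopologicalAddGroup G τ _) (hν : @IsTopologicalAddGroup G ν _)
    (h : @nhds G τ 0 ≤ @nhds G ν 0) : τ ≤ ν :=
  le_of_nhds_le_nhds fun x => by
    rw [← @nhds_translation_add_neg G τ _ hτ x, ← @nhds_translation_add_neg G ν _ hν x]
    exact Filter.comap_mono h

theorem IsMackeyGroup.of_barrelledSpace (E : Type*) [AddCommGroup E] [Module ℝ E]
    [τ : TopologicalSpace E] [hE : IsTopologicalAddGroup E] [ContinuousSMul ℝ E]
    [LocallyConvexSpace ℝ E] [T2Space E] [BarrelledSpace ℝ E] : IsMackeyGroup E :=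
  ⟨.of_locallyConvexSpace E, fun _ hν hcomp =>
    TopologicalSpace.le_of_nhds_zero_le hE hν.isTopologicalAddGroup fun V hV =>
      let ⟨_, hU, hUq, hUV⟩ := hν.exists_quasiConvex V hV
      Filter.mem_of_superset
        (hUq.mem_nhds_zero_of_barrelledSpace (τ := τ) hν.isTopologicalAddGroup hcomp hU) hUV⟩

/-! ### Functionally bounded sets in realcompact spaces -/

open Filter in
/-- A closed functionally bounded subset `A` of a realcompact space is compact: for an ultrafilter
`F` on `A`, the functions with limit `0` along `F` form a real maximal ideal, and a common zero of
this ideal is a limit of `F`. -/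
theorem IsRealcompact.isCompact_of_isClosed {X : Type*} [TopologicalSpace X] (hX : IsRealcompact X)
    {A : Set X} (hA : IsClosed A) (hb : ∀ f : C(X, ℝ), ∃ M, ∀ x ∈ A, |f x| ≤ M) :
    IsCompact A := by
  have := hX.1
  refine isCompact_iff_ultrafilter_le_nhds.2 fun F hF => ?_
  have hF' : A ∈ (F : Filter X) := le_principal_iff.1 hF
  have hlim : ∀ f : C(X, ℝ), ∃ l : ℝ, Tendsto f F (𝓝 l) := fun f => by
    obtain ⟨M, hM⟩ := hb f
    obtain ⟨l, -, hl⟩ := (isCompact_Icc (a := -M) (b := M)).ultrafilter_le_nhds (F.map f) <| by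
      rw [le_principal_iff]
      exact mem_of_superset (f := (F : Filter X)) hF' fun x hx => abs_le.1 (hM x hx)
    exact ⟨l, hl⟩
  choose l hl using hlim
  have huniq : ∀ {f : C(X, ℝ)} {a : ℝ}, Tendsto f F (𝓝 a) → l f = a :=
    fun h => tendsto_nhds_unique (hl _) h
  let φ : C(X, ℝ) →ₐ[ℝ] ℝ :=
    { toFun := l
      map_one' := huniq tendsto_const_nhds
      map_mul' := fun f g => huniq ((hl f).mul (hl g))
      map_zero' := huniq tendsto_const_nhds
      map_add' := fun f g => huniq ((hl f).add (hl g))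
      commutes' := fun r => huniq tendsto_const_nhds }
  have hφs : Function.Surjective φ := fun r => ⟨algebraMap ℝ _ r, φ.commutes r⟩
  have hreal : IsRealMaximalIdeal (RingHom.ker φ) := by
    refine ⟨RingHom.ker_isMaximal_of_surjective φ hφs, fun z => ?_⟩
    obtain ⟨f, rfl⟩ := Ideal.Quotient.mk_surjective z
    refine ⟨φ f, (Ideal.Quotient.eq.2 ?_).symm⟩
    rw [RingHom.mem_ker, map_sub, sub_eq_zero]
    exact (φ.commutes (φ f)).symm
  obtain ⟨x, hx⟩ := hX.2 _ hreal
  have hFx : (F : Filter X) ≤ 𝓝 x := by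
    intro U hU
    obtain ⟨V, hVU, hVo, hxV⟩ := mem_nhds_iff.1 hU
    obtain ⟨f, hf, hfx, hfV⟩ := CompletelyRegularSpace.completely_regular_isOpen x V hVo hxV
    let g : C(X, ℝ) := ⟨fun y => f y, by fun_prop⟩
    have hg : φ g = 0 := by
      have h0 := hx (g - algebraMap ℝ _ (φ g)) (by
        rw [RingHom.mem_ker, map_sub, sub_eq_zero]; exact (φ.commutes (φ g)).symm)
      have h1 : g x - φ g = 0 := h0
      have h2 : g x = 0 := by simp [g, hfx]
      linarith
    have hgt : Tendsto g F (𝓝 0) := hg ▸ hl g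
    filter_upwards [hgt.eventually_lt_const one_pos] with y hy
    refine hVU (by_contra fun hyV => ?_)
    have : g y = 1 := by simp [g, hfV hyV]
    linarith
  exact ⟨x, hA.mem_of_tendsto (f := id) hFx hF', hFx⟩

/-! ### The support of a seminorm on the space of continuous functions -/

namespace ContinuousMap

variable {X : Type*} [TopologicalSpace X]

/-- The function `f` truncated to values in `[-c, c]`. -/
noncomputable def clip (f : C(X, ℝ)) (c : ℝ) : C(X, ℝ) :=
  ⟨fun x => max (-c) (min c (f x)), by fun_prop⟩

theorem abs_clip_le (f : C(X, ℝ)) {c : ℝ} (hc : 0 ≤ c) (x : X) :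
    |f.clip c x| ≤ c :=
  abs_le.2 ⟨le_max_left _ _, max_le (by linarith) (min_le_left _ _)⟩

theorem clip_eq (f : C(X, ℝ)) {c : ℝ} {x : X} (h : |f x| ≤ c) :
    f.clip c x = f x := by
  have := abs_le.1 h
  simp [clip, this.1, this.2]

end ContinuousMap

/-- The *support* of a seminorm `p` on `C(X, ℝ)`: the points every neighborhood of which carries a
function on which `p` does not vanish. -/
def Seminorm.support {X : Type*} [TopologicalSpace X] (p : Seminorm ℝ C(X, ℝ)) : Set X :=
  {x | ∀ U ∈ 𝓝 x, ∃ f : C(X, ℝ), (∀ y ∉ U, f y = 0) ∧ p f ≠ 0}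

namespace Seminorm

variable {X : Type*} [TopologicalSpace X] {p : Seminorm ℝ C(X, ℝ)}

theorem isClosed_support (p : Seminorm ℝ C(X, ℝ)) : IsClosed p.support := by
  refine isClosed_iff_frequently.2 fun x hx U hU => ?_
  obtain ⟨y, hy, hyU⟩ := (hx.and_eventually (eventually_mem_nhds_iff.2 hU)).exists
  exact hy U hyU

theorem map_add_eq_zero {E : Type*} [AddCommGroup E] [Module ℝ E] (q : Seminorm ℝ E) {f g : E}
    (hf : q f = 0) (hg : q g = 0) : q (f + g) = 0 :=
  le_antisymm ((map_add_le_add q f g).trans (by rw [hf, hg, add_zero])) (apply_nonneg q _)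

theorem map_eq_of_map_sub_eq_zero {E : Type*} [AddCommGroup E] [Module ℝ E] (q : Seminorm ℝ E)
    {f g : E} (h : q (f - g) = 0) : q f = q g := by
  have := abs_sub_map_le_sub q f g
  rw [h] at this
  exact sub_eq_zero.1 (abs_eq_zero.1 (le_antisymm this (abs_nonneg _)))

theorem isClosed_setOf_eq_zero {E : Type*} [AddCommGroup E] [Module ℝ E] [TopologicalSpace E]
    {q : Seminorm ℝ E} (hq : LowerSemicontinuous q) : IsClosed {f | q f = 0} := by
  convert hq.isClosed_preimage 0 using 1
  ext f
  exact ⟨fun h => le_of_eq h, fun h => le_antisymm h (apply_nonneg q f)⟩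

/-- Near a point outside the support there is a cutoff function `h` equal to `1` such that `p`
vanishes on all multiples of `h`. -/
theorem exists_cutoff_of_notMem_support [CompletelyRegularSpace X] {x : X} (hx : x ∉ p.support) :
    ∃ h : C(X, ℝ), (∀ᶠ y in 𝓝 x, h y = 1) ∧ ∀ f, p (f * h) = 0 := by
  simp only [support, Set.mem_ofPred_eq, not_forall, not_exists, not_and, not_not] at hx
  obtain ⟨U, hU, hpU⟩ := hx
  obtain ⟨V, hVU, hVo, hxV⟩ := mem_nhds_iff.1 hU
  obtain ⟨k, hk, hkx, hkV⟩ := CompletelyRegularSpace.completely_regular_isOpen x V hVo hxV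
  have hk' : Continuous fun y => (k y : ℝ) := by fun_prop
  refine ⟨⟨fun y => min 1 (2 * (1 - (k y : ℝ))), by fun_prop⟩, ?_, fun f => hpU _ fun y hy => ?_⟩
  · have : ∀ᶠ y in 𝓝 x, (k y : ℝ) < 1 / 2 :=
      hk'.continuousAt.eventually_lt_const (by simp [hkx])
    filter_upwards [this] with y hy
    simp only [ContinuousMap.coe_mk, min_eq_left_iff]
    linarith
  · have : k y = 1 := hkV fun h => hy (hVU h)
    simp [this]

/-- Cutoff functions `h` and `k` for two sets combine to `h + (1 - h) * k`, which replaces a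
partition of unity. -/
theorem exists_cutoff_of_disjoint_support [CompletelyRegularSpace X] {K : Set X} (hK : IsCompact K)
    (hd : ∀ x ∈ K, x ∉ p.support) :
    ∃ h : C(X, ℝ), (∀ y ∈ K, h y = 1) ∧ ∀ f, p (f * h) = 0 := by
  refine hK.induction_on (p := fun S => ∃ h : C(X, ℝ), (∀ y ∈ S, h y = 1) ∧ ∀ f, p (f * h) = 0)
    ⟨0, by simp⟩ ?_ ?_ ?_
  · rintro S T hST ⟨h, h1, h2⟩
    exact ⟨h, fun y hy => h1 y (hST hy), h2⟩
  · rintro S T ⟨h, h1, h2⟩ ⟨k, k1, k2⟩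
    refine ⟨h + (1 - h) * k, ?_, fun f => ?_⟩
    · rintro y (hy | hy)
      · simp [h1 y hy]
      · simp [k1 y hy]
    · have : f * (h + (1 - h) * k) = f * h + f * (1 - h) * k := by ring
      rw [this]
      exact p.map_add_eq_zero (h2 f) (k2 _)
  · intro x hx
    obtain ⟨h, h1, h2⟩ := exists_cutoff_of_notMem_support (hd x hx)
    exact ⟨_, mem_nhdsWithin_of_mem_nhds h1, h, fun y hy => hy, h2⟩

theorem eq_zero_of_eqOn_zero_of_isOpen [CompletelyRegularSpace X] (hp : LowerSemicontinuous p)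
    {W : Set X} (hW : IsOpen W) (hsW : p.support ⊆ W) {f : C(X, ℝ)} (hf : ∀ x ∈ W, f x = 0) :
    p f = 0 := by
  -- On each compact set `f` agrees with some `f * h` in the closed set where `p` vanishes.
  have hmem : f ∈ closure {g | p g = 0} := by
    refine mem_closure_iff_nhds.2 fun s hs => ?_
    obtain ⟨S, hS, hS', hSs⟩ := ContinuousMap.mem_nhds_iff.1 hs
    have hK : IsCompact (⋃ KU ∈ S, KU.1) :=
      hS.isCompact_biUnion fun KU h => (hS' KU.1 KU.2 h).1
    obtain ⟨h, h1, h2⟩ := exists_cutoff_of_disjoint_support (p := p) (hK.diff hW)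
      fun x hx hxs => hx.2 (hsW hxs)
    refine ⟨f * h, hSs fun K U hKU x hx => ?_, h2 f⟩
    have : (f * h) x = f x := by
      by_cases hxW : x ∈ W
      · simp [hf x hxW]
      · simp [h1 x ⟨Set.mem_biUnion hKU hx, hxW⟩]
    rw [this]
    exact (hS' K U hKU).2.2 hx
  rwa [(isClosed_setOf_eq_zero hp).closure_eq] at hmem

/-- The seminorm `p f` depends only on the restriction of `f` to the support: removing from `f` its
truncation at height `1 / (n + 1)` leaves a function vanishing near the support. -/
theorem eq_zero_of_eqOn_zero [CompletelyRegularSpace X] (hp : LowerSemicontinuous p)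
    {f : C(X, ℝ)} (hf : ∀ x ∈ p.support, f x = 0) : p f = 0 := by
  have hc : Filter.Tendsto (fun n : ℕ => (1 : ℝ) / (n + 1)) Filter.atTop (𝓝 0) :=
    tendsto_one_div_add_atTop_nhds_zero_nat
  have hpos : ∀ n : ℕ, (0 : ℝ) < 1 / (n + 1) := fun n => by positivity
  suffices H : f ∈ {g | p g = 0} from H
  refine (isClosed_setOf_eq_zero hp).mem_of_tendsto
    (f := fun n : ℕ => f - f.clip (1 / (n + 1))) (b := Filter.atTop) ?_
    (Filter.Eventually.of_forall fun n => ?_)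
  · refine ContinuousMap.tendsto_of_tendstoLocallyUniformly
      (TendstoUniformly.tendstoLocallyUniformly ?_)
    refine Metric.tendstoUniformly_iff.2 fun ε hε => ?_
    filter_upwards [hc.eventually_lt_const hε] with n hn x
    rw [Real.dist_eq]
    simpa using (f.abs_clip_le (hpos n).le x).trans_lt hn
  · refine eq_zero_of_eqOn_zero_of_isOpen hp (W := {x | |f x| < 1 / (n + 1)})
      (isOpen_lt (by fun_prop) (by fun_prop)) (fun x hx => ?_) fun x hx => ?_
    · simpa [hf x hx] using hpos n
    · rw [ContinuousMap.sub_apply, f.clip_eq (le_of_lt hx), sub_self]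

/-- The support of a lower semicontinuous seminorm `p` is functionally bounded: if `h` is unbounded
on it, there are `f n` with `p (f n) ≠ 0` vanishing where `|h| ≤ n`. The seminorm
`a ↦ p (∑ a n • f n)` on the Fréchet space `ℕ → ℝ` is continuous, so it depends on
finitely many coordinates only, a contradiction. -/
theorem exists_forall_mem_support_abs_le (hp : LowerSemicontinuous p) (h : C(X, ℝ)) :
    ∃ M, ∀ x ∈ p.support, |h x| ≤ M := by
  by_contra! hunb
  have hf : ∀ n : ℕ, ∃ f : C(X, ℝ), (∀ y, |h y| ≤ n → f y = 0) ∧ p f ≠ 0 := fun n => by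
    obtain ⟨x, hx, hxn⟩ := hunb n
    obtain ⟨f, hf, hpf⟩ := hx {y | n < |h y|}
      ((isOpen_lt (by fun_prop) (by fun_prop)).mem_nhds hxn)
    exact ⟨f, fun y hy => hf y (not_lt.2 hy), hpf⟩
  choose f hf hpf using hf
  have hloc : ∀ x, ∃ N : ℕ, ∀ᶠ y in 𝓝 x, ∀ n, N ≤ n → f n y = 0 := fun x => by
    obtain ⟨N, hN⟩ := exists_nat_gt |h x|
    have : ∀ᶠ y in 𝓝 x, |h y| < N :=
      (Continuous.continuousAt (by fun_prop)).eventually_lt_const hN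
    refine ⟨N, ?_⟩
    filter_upwards [this] with y hy n hn
    exact hf n y (hy.le.trans (by exact_mod_cast hn))
  have hsum : ∀ (a : ℕ → ℝ) {x : X} {N : ℕ}, (∀ n, N ≤ n → f n x = 0) →
      ∑ᶠ n, a n * f n x = ∑ n ∈ Finset.range N, a n * f n x := fun a x N hN =>
    finsum_eq_sum_of_support_subset _ fun n hn => by
      by_contra hcon
      exact hn (by simp [hN n (by simpa using hcon)])
  have hcont : Continuous fun q : (ℕ → ℝ) × X => ∑ᶠ n, q.1 n * f n q.2 := by
    refine continuous_iff_continuousAt.2 fun q => ?_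
    obtain ⟨N, hN⟩ := hloc q.2
    have h1 : ContinuousAt (fun q : (ℕ → ℝ) × X => ∑ n ∈ Finset.range N, q.1 n * f n q.2) q :=
      Continuous.continuousAt (by fun_prop)
    refine h1.congr ?_
    filter_upwards [continuous_snd.continuousAt.eventually hN] with q hq
    exact (hsum q.1 hq).symm
  let Φ : (ℕ → ℝ) →ₗ[ℝ] C(X, ℝ) :=
    { toFun := fun a => ⟨fun x => ∑ᶠ n, a n * f n x, hcont.comp (Continuous.prodMk_right a)⟩
      map_add' := fun a b => by
        ext x
        obtain ⟨N, hN⟩ := hloc x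
        change ∑ᶠ n, (a + b) n * f n x = ∑ᶠ n, a n * f n x + ∑ᶠ n, b n * f n x
        rw [hsum _ hN.self_of_nhds, hsum _ hN.self_of_nhds, hsum _ hN.self_of_nhds]
        simp only [Pi.add_apply, add_mul, Finset.sum_add_distrib]
      map_smul' := fun c a => by
        ext x
        obtain ⟨N, hN⟩ := hloc x
        change ∑ᶠ n, (c • a) n * f n x = c * ∑ᶠ n, a n * f n x
        rw [hsum _ hN.self_of_nhds, hsum _ hN.self_of_nhds]
        simp only [Pi.smul_apply, smul_eq_mul, Finset.mul_sum, mul_assoc] }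
  have hΦ : Continuous Φ := ContinuousMap.continuous_of_continuous_uncurry _ hcont
  have hq : Continuous (p.comp Φ) :=
    (p.comp Φ).continuous_of_lowerSemicontinuous <|
      show LowerSemicontinuous (p ∘ Φ) from LowerSemicontinuous.comp hp hΦ
  have hΦs : ∀ n, Φ (Pi.single n 1) = f n := fun n => by
    ext x
    change ∑ᶠ k, (Pi.single n 1 : ℕ → ℝ) k * f k x = f n x
    rw [finsum_eq_single _ n fun k hk => by simp [hk]]
    simp
  -- Coordinate vectors `c n • e n` tend to `0` whatever the scalars `c n`.
  have hlim : Filter.Tendsto (fun n : ℕ => (p (f n))⁻¹ • (Pi.single n 1 : ℕ → ℝ)) Filter.atTop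
      (𝓝 0) := by
    refine tendsto_pi_nhds.2 fun k => tendsto_const_nhds.congr' ?_
    filter_upwards [Filter.eventually_gt_atTop k] with n hn
    simp [hn.ne]
  have h1 := (hq.tendsto 0).comp hlim
  have h2 : (p.comp Φ ∘ fun n : ℕ => (p (f n))⁻¹ • (Pi.single n 1 : ℕ → ℝ)) = fun _ => 1 := by
    funext n
    simp only [Function.comp_apply, Seminorm.comp_apply, map_smul_eq_mul, hΦs, norm_inv,
      Real.norm_of_nonneg (apply_nonneg p (f n))]
    exact inv_mul_cancel₀ (hpf n)
  rw [h2, map_zero] at h1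
  exact one_ne_zero (tendsto_nhds_unique tendsto_const_nhds h1)

/-- A lower semicontinuous seminorm `p` is bounded by a multiple of the supremum over its support:
`p` is continuous on the Banach space of bounded functions, and depends on values in the support
only. -/
theorem exists_le_mul_of_forall_mem_support [CompletelyRegularSpace X]
    (hp : LowerSemicontinuous p) :
    ∃ C > 0, ∀ (f : C(X, ℝ)) (c : ℝ), 0 ≤ c → (∀ x ∈ p.support, |f x| ≤ c) → p f ≤ C * c := by
  let Φ := BoundedContinuousFunction.toContinuousMapLinearMap X ℝ ℝ
  have hΦ : Continuous Φ := ContinuousMap.continuous_of_continuous_uncurry _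
    (continuous_eval (F := BoundedContinuousFunction X ℝ))
  obtain ⟨C, hC, hpC⟩ := Seminorm.bound_of_continuous_normedSpace (p.comp Φ)
    ((p.comp Φ).continuous_of_lowerSemicontinuous <|
      show LowerSemicontinuous (p ∘ Φ) from LowerSemicontinuous.comp hp hΦ)
  refine ⟨C, hC, fun f c hc hf => ?_⟩
  have heq : p f = p (f.clip c) := p.map_eq_of_map_sub_eq_zero <|
    eq_zero_of_eqOn_zero hp fun x hx => by simp [f.clip_eq (hf x hx)]
  let g : BoundedContinuousFunction X ℝ := .ofNormedAddCommGroup (f.clip c) (map_continuous _) c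
    fun x => f.abs_clip_le hc x
  have hg : ‖g‖ ≤ c := (BoundedContinuousFunction.norm_le hc).2 fun x => f.abs_clip_le hc x
  calc p f = p.comp Φ g := heq
    _ ≤ C * ‖g‖ := hpC g
    _ ≤ C * c := by gcongr

end Seminorm

/-! ### Barrelledness for realcompact spaces -/

/-- Nachbin and Shirota: `C(X, ℝ)` is barrelled for a realcompact space `X`, since the support of a
lower semicontinuous seminorm is compact. -/
theorem IsRealcompact.barrelledSpace {X : Type*} [TopologicalSpace X] (hX : IsRealcompact X) :
    BarrelledSpace ℝ C(X, ℝ) where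
  continuous_of_lowerSemicontinuous p hp := by
    have := hX.1
    have hK : IsCompact p.support := hX.isCompact_of_isClosed p.isClosed_support
      (p.exists_forall_mem_support_abs_le hp)
    obtain ⟨C, hC, hpC⟩ := p.exists_le_mul_of_forall_mem_support hp
    refine Seminorm.continuous' (r := C) ?_
    have hnhds := ContinuousMap.eventually_mapsTo (f := (0 : C(X, ℝ))) hK
      (Metric.isOpen_ball (x := (0 : ℝ)) (ε := 1)) fun x _ => by simp
    filter_upwards [hnhds] with f hf
    rw [Seminorm.mem_closedBall_zero]
    simpa using hpC f 1 zero_le_one fun x hx => by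
      have := hf hx
      rw [mem_ball_zero_iff] at this
      exact this.le

/-- `C(X, ℝ)` carries the compact-open topology. -/
theorem theorem1p4 {X : Type*} [TopologicalSpace X] (hX : IsRealcompact X) :
    BarrelledSpace ℝ C(X, ℝ) ↔ IsMackeyGroup C(X, ℝ) :=
  ⟨fun _ => .of_barrelledSpace C(X, ℝ), fun _ => hX.barrelledSpace⟩
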